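/- **The punctual Weierstrass theorem.** Fix the standard numberings by natural numbers of $\mathbb{Q}$ (an index codes a triple $(a,b,d)\in\mathbb{N}^3$ and denotes $(a-b)/(d+1)$) and of $\mathbb{Q}[X]$ (an index codes the finite list of indices of the coefficients). A sequence $(r_i)_{i\in\mathbb{N}}$ of rational numbers is a *fast Cauchy sequence* if $|r_i-r_{i+1}|<2^{-i}$ for every $i\in\mathbb{N}$; it is identified with the function $\mathbb{N}\to\mathbb{N}$ listing indices of its terms. A *primitive recursive functional* is a map $\Phi$ taking $\chi:\mathbb{N}\to\mathbb{N}$ (the oracle) and $n\in\mathbb{N}$ to $\Phi^\chi(n)\in\mathbb{N}$ that is defined by a primitive recursive scheme, the same for all $\chi$, in which $\chi$ is allowed as an additional basic function. A function $f:[0,1]\to\mathbb{R}$ is *punctually computable* if there is a primitive recursive functional $\Phi$ such that, for every $x\in[0,1]$ and every fast Cauchy sequence $\chi$ of rationals converging to $x$, the sequence $(\Phi^\chi(n))_{n\in\mathbb{N}}$ is a fast Cauchy sequence of rationals converging to $f(x)$. It is *uniformly punctually computable* if there is a primitive recursive function which on input $i\in\mathbb{N}$ outputs an index of a polynomial $p_i$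 with rational coefficients such that $$\sup_{x\in[0,1]}|f(x)-p_i(x)|<2^{-i}.$$ **Theorem.** Every punctually computable function $f:[0,1]\to\mathbb{R}$ is uniformly punctually computable. -/

import Mathlib

open Filter Topology

/-- Primitive recursive functionals `Φ : (ℕ → ℕ) → ℕ → ℕ`, `(g, n) ↦ Φ^g(n)`: those given by a
primitive recursive scheme to which the oracle `g` has been added as a basic function. One and the
same scheme is used for all oracles. As in Mathlib's `Nat.Primrec`, functions of several arguments
are handled through the pairing function `Nat.pair`. -/
inductive IsPrimrecFunctional : ((ℕ → ℕ) → ℕ → ℕ) → Prop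
  | zero : IsPrimrecFunctional fun _ _ => 0
  | succ : IsPrimrecFunctional fun _ n => n + 1
  | left : IsPrimrecFunctional fun _ n => n.unpair.1
  | right : IsPrimrecFunctional fun _ n => n.unpair.2
  | oracle : IsPrimrecFunctional fun g n => g n
  | pair {Φ Ψ : (ℕ → ℕ) → ℕ → ℕ} :
      IsPrimrecFunctional Φ → IsPrimrecFunctional Ψ →
        IsPrimrecFunctional fun g n => Nat.pair (Φ g n) (Ψ g n)
  | comp {Φ Ψ : (ℕ → ℕ) → ℕ → ℕ} :
      IsPrimrecFunctional Φ → IsPrimrecFunctional Ψ →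
        IsPrimrecFunctional fun g n => Φ g (Ψ g n)
  | prec {Φ Ψ : (ℕ → ℕ) → ℕ → ℕ} :
      IsPrimrecFunctional Φ → IsPrimrecFunctional Ψ →
        IsPrimrecFunctional fun g n =>
          Nat.rec (motive := fun _ => ℕ) (Φ g n.unpair.1)
            (fun y ih => Ψ g (Nat.pair n.unpair.1 (Nat.pair y ih))) n.unpair.2

/-- The standard numbering of the rationals: `⟨⟨a, b⟩, d⟩` is an index of `(a - b) / (d + 1)`. -/
def ratOfCode (n : ℕ) : ℚ :=
  ((n.unpair.1.unpair.1 : ℚ) - (n.unpair.1.unpair.2 : ℚ)) / ((n.unpair.2 : ℚ) + 1)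

/-- A sequence of rationals is a fast Cauchy sequence if `|r i - r (i + 1)| < 2 ^ (-i)` for
every `i`. -/
def IsFastCauchy (r : ℕ → ℚ) : Prop :=
  ∀ i : ℕ, |r i - r (i + 1)| < (1 / 2 : ℚ) ^ i

/-- `χ` is (a sequence of indices of) a fast Cauchy sequence of rationals converging to `x`. -/
def IsFastCauchyName (χ : ℕ → ℕ) (x : ℝ) : Prop :=
  IsFastCauchy (fun i => ratOfCode (χ i)) ∧
    Tendsto (fun i => (ratOfCode (χ i) : ℝ)) atTop (𝓝 x)

/-- A primitive recursive functional turns every fast Cauchy name of every `x ∈ [0,1]` into a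
fast Cauchy name of `f x`. -/
def PunctuallyComputable (f : Set.Icc (0 : ℝ) 1 → ℝ) : Prop :=
  ∃ Φ : (ℕ → ℕ) → ℕ → ℕ, IsPrimrecFunctional Φ ∧
    ∀ (x : Set.Icc (0 : ℝ) 1) (χ : ℕ → ℕ),
      IsFastCauchyName χ (x : ℝ) → IsFastCauchyName (Φ χ) (f x)

/-- The polynomial with rational coefficients whose list of coefficients, from the constant term
upwards, has the given list of indices. -/
noncomputable def polyOfCodes : List ℕ → Polynomial ℚ
  | [] => 0
  | c :: l => Polynomial.C (ratOfCode c) + Polynomial.X * polyOfCodes l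

/-- A primitive recursive function outputs, on input `i`, a rational polynomial `p i` with
`sup_{x ∈ [0,1]} |f x - p i x| < 2 ^ (-i)`. The supremum is required to be finite, so that the real
supremum in the second conjunct is the true one. -/
def UniformlyPunctuallyComputable (f : Set.Icc (0 : ℝ) 1 → ℝ) : Prop :=
  ∃ c : ℕ → List ℕ, Primrec c ∧ ∀ i : ℕ,
    BddAbove (Set.range fun x : Set.Icc (0 : ℝ) 1 =>
      |f x - Polynomial.aeval (x : ℝ) (polyOfCodes (c i))|) ∧
    (⨆ x : Set.Icc (0 : ℝ) 1,
      |f x - Polynomial.aeval (x : ℝ) (polyOfCodes (c i))|) < (1 / 2 : ℝ) ^ i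

/-! Every point of `[0,1]` has a name by dyadic truncations, and all these names lie below one
monotone primitive recursive function. By induction on the scheme,
`IsPrimrecFunctional.exists_primrec_bound` turns this into a primitive recursive `B` bounding both
the values of `Φ` and the part of the oracle that it reads. Nearby points share names up to any
prescribed place (`isFastCauchyName_ite`), so `2 ^ (-B n)` is a modulus of continuity for `f`, and
`B 0` yields a bound on `|f|`.

Bernstein's proof is then effective: its error (`abs_sub_sum_bernstein_le`) depends only on the
bound, the modulus and the degree, so a sufficient degree is primitive recursive in the precision.
The coefficients are values of `Φ` at rational nodes, whose names are primitive recursive, hence so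
are the coefficients (`IsPrimrecFunctional.primrec₂`). -/

/-! ### Primitive recursive functionals: evaluation and bounds -/

/-- A primitive recursive functional, applied to a primitive recursive family of oracles, gives a
primitive recursive function. -/
theorem IsPrimrecFunctional.primrec₂ {α : Type*} [Primcodable α] {g : α → ℕ → ℕ}
    (hg : Primrec₂ g) {Φ : (ℕ → ℕ) → ℕ → ℕ} (hΦ : IsPrimrecFunctional Φ) :
    Primrec₂ fun a n => Φ (g a) n := by
  induction hΦ with
  | zero => exact Primrec.const 0
  | succ => exact Primrec.succ.comp Primrec.snd
  | left => exact Primrec.fst.comp (Primrec.unpair.comp Primrec.snd)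
  | right => exact Primrec.snd.comp (Primrec.unpair.comp Primrec.snd)
  | oracle => exact hg
  | pair _ _ h₁ h₂ => exact Primrec₂.natPair.comp h₁ h₂
  | comp _ _ h₁ h₂ => exact h₁.comp Primrec.fst h₂
  | @prec Φ Ψ _ _ h₁ h₂ =>
    have hu : Primrec fun p : α × ℕ => p.2.unpair := Primrec.unpair.comp Primrec.snd
    refine Primrec.nat_rec' (h := fun p q =>
      Ψ (g p.1) (Nat.pair p.2.unpair.1 (Nat.pair q.1 q.2))) (Primrec.snd.comp hu)
      (h₁.comp Primrec.fst (Primrec.fst.comp hu)) ?_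
    refine h₂.comp (Primrec.fst.comp Primrec.fst) ?_
    exact Primrec₂.natPair.comp (Primrec.fst.comp (hu.comp Primrec.fst))
      (Primrec₂.natPair.comp (Primrec.fst.comp Primrec.snd) (Primrec.snd.comp Primrec.snd))

theorem Nat.pair_le_pair_of_le {a b c d : ℕ} (h₁ : a ≤ c) (h₂ : b ≤ d) :
    Nat.pair a b ≤ Nat.pair c d := by
  rcases h₁.eq_or_lt with rfl | h₁
  · rcases h₂.eq_or_lt with rfl | h₂
    · exact le_rfl
    · exact (Nat.pair_lt_pair_right _ h₂).le
  · rcases h₂.eq_or_lt with rfl | h₂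
    · exact (Nat.pair_lt_pair_left _ h₁).le
    · exact ((Nat.pair_lt_pair_left _ h₁).trans (Nat.pair_lt_pair_right _ h₂)).le

/-- On oracles bounded by a monotone primitive recursive function, both the values and the use of
a primitive recursive functional are bounded by a primitive recursive function. -/
theorem IsPrimrecFunctional.exists_primrec_bound {h : ℕ → ℕ} (hh : Primrec h) (hmono : Monotone h)
    {Φ : (ℕ → ℕ) → ℕ → ℕ} (hΦ : IsPrimrecFunctional Φ) :
    ∃ B : ℕ → ℕ, Primrec B ∧ ∀ n m, m ≤ n → ∀ g : ℕ → ℕ, (∀ i, g i ≤ h i) →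
      Φ g m ≤ B n ∧ ∀ g' : ℕ → ℕ, (∀ i < B n, g' i = g i) → Φ g' m = Φ g m := by
  induction hΦ with
  | zero => exact ⟨fun _ => 0, Primrec.const 0, fun _ _ _ _ _ => ⟨le_rfl, fun _ _ => rfl⟩⟩
  | succ =>
    exact ⟨fun n => n + 1, Primrec.succ, fun _ _ hm _ _ => ⟨by lia, fun _ _ => rfl⟩⟩
  | left =>
    exact ⟨id, Primrec.id, fun _ m hm _ _ => ⟨(Nat.unpair_left_le m).trans hm, fun _ _ => rfl⟩⟩
  | right =>
    exact ⟨id, Primrec.id, fun _ m hm _ _ => ⟨(Nat.unpair_right_le m).trans hm, fun _ _ => rfl⟩⟩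
  | oracle =>
    -- `h n` bounds the value; `n + 1` puts the query `m ≤ n` strictly below the bound.
    refine ⟨fun n => h n + (n + 1), Primrec.nat_add.comp hh Primrec.succ, fun n m hm g hg => ?_⟩
    exact ⟨((hg m).trans (hmono hm)).trans (Nat.le_add_right _ _), fun g' hg' => hg' m (by lia)⟩
  | pair _ _ h₁ h₂ =>
    obtain ⟨B₁, hB₁, h₁⟩ := h₁
    obtain ⟨B₂, hB₂, h₂⟩ := h₂
    refine ⟨fun n => Nat.pair (B₁ n) (B₂ n), Primrec₂.natPair.comp hB₁ hB₂, fun n m hm g hg => ?_⟩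
    obtain ⟨h₁, u₁⟩ := h₁ n m hm g hg
    obtain ⟨h₂, u₂⟩ := h₂ n m hm g hg
    refine ⟨Nat.pair_le_pair_of_le h₁ h₂, fun g' hg' => ?_⟩
    simp only
    rw [u₁ g' fun i hi => hg' i (hi.trans_le (Nat.left_le_pair _ _)),
      u₂ g' fun i hi => hg' i (hi.trans_le (Nat.right_le_pair _ _))]
  | comp _ _ h₁ h₂ =>
    obtain ⟨B₁, hB₁, h₁⟩ := h₁
    obtain ⟨B₂, hB₂, h₂⟩ := h₂
    refine ⟨fun n => B₁ (B₂ n) + B₂ n, Primrec.nat_add.comp (hB₁.comp hB₂) hB₂,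
      fun n m hm g hg => ?_⟩
    obtain ⟨h₂, u₂⟩ := h₂ n m hm g hg
    obtain ⟨h₁, u₁⟩ := h₁ (B₂ n) _ h₂ g hg
    refine ⟨h₁.trans (Nat.le_add_right _ _), fun g' hg' => ?_⟩
    simp only
    rw [u₂ g' fun i hi => hg' i (by lia), u₁ g' fun i hi => hg' i (by lia)]
  | @prec Φ Ψ _ _ h₁ h₂ =>
    obtain ⟨B₁, hB₁, h₁⟩ := h₁
    obtain ⟨B₂, hB₂, h₂⟩ := h₂
    -- Pairing is monotone, so `Nat.pair n (Nat.pair n c)` dominates every argument passed to `Ψ`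
    -- while the value is at most `c`. Adding, rather than replacing, keeps the use of earlier
    -- stages covered.
    let C : ℕ → ℕ → ℕ := fun n y =>
      Nat.rec (motive := fun _ => ℕ) (B₁ n) (fun _ c => c + B₂ (Nat.pair n (Nat.pair n c))) y
    have hCmono : ∀ n, Monotone (C n) := fun n =>
      monotone_nat_of_le_succ fun y => Nat.le_add_right _ _
    have key : ∀ (n a y : ℕ), a ≤ n → y ≤ n → ∀ g : ℕ → ℕ, (∀ i, g i ≤ h i) →
        Nat.rec (motive := fun _ => ℕ) (Φ g a)
          (fun y ih => Ψ g (Nat.pair a (Nat.pair y ih))) y ≤ C n y ∧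
        ∀ g' : ℕ → ℕ, (∀ i < C n y, g' i = g i) →
          Nat.rec (motive := fun _ => ℕ) (Φ g' a)
            (fun y ih => Ψ g' (Nat.pair a (Nat.pair y ih))) y =
          Nat.rec (motive := fun _ => ℕ) (Φ g a)
            (fun y ih => Ψ g (Nat.pair a (Nat.pair y ih))) y := by
      intro n a y ha hy g hg
      induction y with
      | zero => exact h₁ n a ha g hg
      | succ y ih =>
        obtain ⟨hv, hu⟩ := ih (by lia)
        obtain ⟨hv', hu'⟩ := h₂ (Nat.pair n (Nat.pair n (C n y))) _
          (Nat.pair_le_pair_of_le ha (Nat.pair_le_pair_of_le (by lia : y ≤ n) hv)) g hg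
        have hle : C n y ≤ C n (y + 1) := hCmono n (Nat.le_succ y)
        have hle' : B₂ (Nat.pair n (Nat.pair n (C n y))) ≤ C n (y + 1) := Nat.le_add_left _ _
        refine ⟨hv'.trans hle', fun g' hg' => ?_⟩
        simp only
        rw [hu g' fun i hi => hg' i (hi.trans_le hle), hu' g' fun i hi => hg' i (hi.trans_le hle')]
    refine ⟨fun n => C n n, ?_, fun n m hm g hg => ?_⟩
    · refine Primrec.nat_rec' (h := fun n q => q.2 + B₂ (Nat.pair n (Nat.pair n q.2))) Primrec.id hB₁ ?_
      have hc : Primrec fun p : ℕ × ℕ × ℕ => p.2.2 := Primrec.snd.comp Primrec.snd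
      exact Primrec.nat_add.comp hc (hB₂.comp (Primrec₂.natPair.comp Primrec.fst
        (Primrec₂.natPair.comp Primrec.fst hc)))
    · have hy := (Nat.unpair_right_le m).trans hm
      obtain ⟨hv, hu⟩ := key n m.unpair.1 m.unpair.2 ((Nat.unpair_left_le m).trans hm) hy g hg
      exact ⟨hv.trans (hCmono n hy), fun g' hg' =>
        hu g' fun i hi => hg' i (hi.trans_le (hCmono n hy))⟩

/-! ### Primitive recursive arithmetic -/

theorem Primrec.nat_pow : Primrec₂ ((· ^ ·) : ℕ → ℕ → ℕ) := by
  refine (Primrec.nat_rec' (f := fun p : ℕ × ℕ => p.2) (g := fun _ => 1)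
    (h := fun p q => q.2 * p.1) Primrec.snd (Primrec.const 1) ?_).of_eq fun p => ?_
  · exact Primrec.nat_mul.comp (Primrec.snd.comp Primrec.snd) (Primrec.fst.comp Primrec.fst)
  · rcases p with ⟨a, n⟩
    induction n with
    | zero => simp
    | succ n ih => exact (congrArg (· * a) ih).trans (pow_succ a n).symm

theorem Primrec.nat_factorial : Primrec Nat.factorial := by
  refine (Primrec.nat_rec' (f := fun n : ℕ => n) (g := fun _ => 1)
    (h := fun _ q => (q.1 + 1) * q.2) Primrec.id (Primrec.const 1) ?_).of_eq fun n => ?_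
  · exact Primrec.nat_mul.comp (Primrec.succ.comp (Primrec.fst.comp Primrec.snd))
      (Primrec.snd.comp Primrec.snd)
  · induction n with
    | zero => rfl
    | succ n ih => exact congrArg ((n + 1) * ·) ih

theorem Primrec.nat_descFactorial : Primrec₂ Nat.descFactorial := by
  refine (Primrec.nat_rec' (f := fun p : ℕ × ℕ => p.2) (g := fun _ => 1)
    (h := fun p q => (p.1 - q.1) * q.2) Primrec.snd (Primrec.const 1) ?_).of_eq fun p => ?_
  · exact Primrec.nat_mul.comp (Primrec.nat_sub.comp (Primrec.fst.comp Primrec.fst)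
      (Primrec.fst.comp Primrec.snd)) (Primrec.snd.comp Primrec.snd)
  · rcases p with ⟨a, n⟩
    induction n with
    | zero => rfl
    | succ n ih => exact congrArg ((a - n) * ·) ih

theorem Primrec.nat_choose : Primrec₂ Nat.choose :=
  (Primrec.nat_div.comp Primrec.nat_descFactorial
    (Primrec.nat_factorial.comp Primrec.snd)).of_eq fun p =>
      (Nat.choose_eq_descFactorial_div_factorial p.1 p.2).symm

/-! ### Arithmetic on indices -/

/-- Addition on indices of rationals. -/
def addCode (m n : ℕ) : ℕ :=
  Nat.pair
    (Nat.pair (m.unpair.1.unpair.1 * (n.unpair.2 + 1) + n.unpair.1.unpair.1 * (m.unpair.2 + 1))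
      (m.unpair.1.unpair.2 * (n.unpair.2 + 1) + n.unpair.1.unpair.2 * (m.unpair.2 + 1)))
    (m.unpair.2 * n.unpair.2 + m.unpair.2 + n.unpair.2)

/-- Multiplication on indices of rationals. -/
def mulCode (m n : ℕ) : ℕ :=
  Nat.pair
    (Nat.pair
      (m.unpair.1.unpair.1 * n.unpair.1.unpair.1 + m.unpair.1.unpair.2 * n.unpair.1.unpair.2)
      (m.unpair.1.unpair.1 * n.unpair.1.unpair.2 + m.unpair.1.unpair.2 * n.unpair.1.unpair.1))
    (m.unpair.2 * n.unpair.2 + m.unpair.2 + n.unpair.2)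

theorem ratOfCode_pair (a b d : ℕ) :
    ratOfCode (Nat.pair (Nat.pair a b) d) = ((a : ℚ) - b) / (d + 1) := by
  simp [ratOfCode]

theorem ratOfCode_addCode (m n : ℕ) : ratOfCode (addCode m n) = ratOfCode m + ratOfCode n := by
  have h₁ : ((m.unpair.2 : ℚ) + 1) ≠ 0 := by positivity
  have h₂ : ((n.unpair.2 : ℚ) + 1) ≠ 0 := by positivity
  rw [addCode, ratOfCode_pair, ratOfCode, ratOfCode, div_add_div _ _ h₁ h₂]
  push_cast
  congr 1 <;> ring

theorem ratOfCode_mulCode (m n : ℕ) : ratOfCode (mulCode m n) = ratOfCode m * ratOfCode n := by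
  rw [mulCode, ratOfCode_pair, ratOfCode, ratOfCode, div_mul_div_comm]
  push_cast
  congr 1 <;> ring

theorem ratOfCode_zero : ratOfCode 0 = 0 := by
  simp [ratOfCode]

/-- An index dominates its components, and denominators are at least 1. This converts bounds on
values of `Φ` into bounds on rationals. -/
theorem abs_ratOfCode_le (n : ℕ) : |ratOfCode n| ≤ n := by
  have ha : ((n.unpair.1.unpair.1 : ℕ) : ℚ) ≤ n :=
    mod_cast (Nat.unpair_left_le _).trans (Nat.unpair_left_le n)
  have hb : ((n.unpair.1.unpair.2 : ℕ) : ℚ) ≤ n :=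
    mod_cast (Nat.unpair_right_le _).trans (Nat.unpair_left_le n)
  have ha' : (0 : ℚ) ≤ n.unpair.1.unpair.1 := Nat.cast_nonneg _
  have hb' : (0 : ℚ) ≤ n.unpair.1.unpair.2 := Nat.cast_nonneg _
  have hd : (1 : ℚ) ≤ n.unpair.2 + 1 := le_add_of_nonneg_left (Nat.cast_nonneg _)
  rw [ratOfCode, abs_div, abs_of_nonneg (zero_le_one.trans hd)]
  exact (div_le_self (abs_nonneg _) hd).trans (abs_le.2 ⟨by linarith, by linarith⟩)

theorem primrec_addCode : Primrec₂ addCode := by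
  have hm : Primrec fun p : ℕ × ℕ => p.1.unpair := Primrec.unpair.comp Primrec.fst
  have hn : Primrec fun p : ℕ × ℕ => p.2.unpair := Primrec.unpair.comp Primrec.snd
  have hm₁ := Primrec.unpair.comp (Primrec.fst.comp hm)
  have hn₁ := Primrec.unpair.comp (Primrec.fst.comp hn)
  have hm₂ := Primrec.snd.comp hm
  have hn₂ := Primrec.snd.comp hn
  exact Primrec₂.natPair.comp
    (Primrec₂.natPair.comp
      (Primrec.nat_add.comp
        (Primrec.nat_mul.comp (Primrec.fst.comp hm₁) (Primrec.succ.comp hn₂))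
        (Primrec.nat_mul.comp (Primrec.fst.comp hn₁) (Primrec.succ.comp hm₂)))
      (Primrec.nat_add.comp
        (Primrec.nat_mul.comp (Primrec.snd.comp hm₁) (Primrec.succ.comp hn₂))
        (Primrec.nat_mul.comp (Primrec.snd.comp hn₁) (Primrec.succ.comp hm₂))))
    (Primrec.nat_add.comp (Primrec.nat_add.comp (Primrec.nat_mul.comp hm₂ hn₂) hm₂) hn₂)

theorem primrec_mulCode : Primrec₂ mulCode := by
  have hm : Primrec fun p : ℕ × ℕ => p.1.unpair := Primrec.unpair.comp Primrec.fst
  have hn : Primrec fun p : ℕ × ℕ => p.2.unpair := Primrec.unpair.comp Primrec.snd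
  have hm₁ := Primrec.unpair.comp (Primrec.fst.comp hm)
  have hn₁ := Primrec.unpair.comp (Primrec.fst.comp hn)
  have hm₂ := Primrec.snd.comp hm
  have hn₂ := Primrec.snd.comp hn
  exact Primrec₂.natPair.comp
    (Primrec₂.natPair.comp
      (Primrec.nat_add.comp
        (Primrec.nat_mul.comp (Primrec.fst.comp hm₁) (Primrec.fst.comp hn₁))
        (Primrec.nat_mul.comp (Primrec.snd.comp hm₁) (Primrec.snd.comp hn₁)))
      (Primrec.nat_add.comp
        (Primrec.nat_mul.comp (Primrec.fst.comp hm₁) (Primrec.snd.comp hn₁))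
        (Primrec.nat_mul.comp (Primrec.snd.comp hm₁) (Primrec.fst.comp hn₁))))
    (Primrec.nat_add.comp (Primrec.nat_add.comp (Primrec.nat_mul.comp hm₂ hn₂) hm₂) hn₂)

/-- An index of the sum of the rationals with indices `c 0, …, c (n - 1)`. -/
def sumCode (c : ℕ → ℕ) (n : ℕ) : ℕ :=
  Nat.rec (motive := fun _ => ℕ) 0 (fun k s => addCode s (c k)) n

theorem ratOfCode_sumCode (c : ℕ → ℕ) (n : ℕ) :
    ratOfCode (sumCode c n) = ∑ k ∈ Finset.range n, ratOfCode (c k) := by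
  induction n with
  | zero => exact ratOfCode_zero
  | succ n ih =>
    rw [Finset.sum_range_succ, ← ih]
    exact ratOfCode_addCode _ _

theorem primrec_sumCode {α : Type*} [Primcodable α] {c : α → ℕ → ℕ} (hc : Primrec₂ c)
    {n : α → ℕ} (hn : Primrec n) : Primrec fun a => sumCode (c a) (n a) := by
  refine Primrec.nat_rec' (h := fun a q => addCode q.2 (c a q.1)) hn (Primrec.const 0) ?_
  exact primrec_addCode.comp (Primrec.snd.comp Primrec.snd)
    (hc.comp Primrec.fst (Primrec.fst.comp Primrec.snd))

theorem polyOfCodes_map_range (c : ℕ → ℕ) (n : ℕ) :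
    polyOfCodes ((List.range n).map c) =
      ∑ m ∈ Finset.range n, Polynomial.C (ratOfCode (c m)) * Polynomial.X ^ m := by
  induction n generalizing c with
  | zero => rfl
  | succ n ih =>
    rw [List.range_succ_eq_map, List.map_cons, List.map_map, polyOfCodes, ih,
      Finset.sum_range_succ', Finset.mul_sum, add_comm]
    congr 1
    · refine Finset.sum_congr rfl fun m _ => ?_
      simp only [Function.comp_apply, Nat.succ_eq_add_one]
      ring
    · simp

theorem Primrec.nat_two_pow : Primrec fun n : ℕ => 2 ^ n :=
  Primrec.nat_pow.comp (Primrec.const 2) Primrec.id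

/-! ### Dyadic names of reals -/

theorem IsFastCauchyName.abs_sub_le {χ : ℕ → ℕ} {x : ℝ} (h : IsFastCauchyName χ x) (n : ℕ) :
    |x - (ratOfCode (χ n) : ℝ)| ≤ 2 / 2 ^ n := by
  have hd : ∀ i, dist (ratOfCode (χ i) : ℝ) (ratOfCode (χ (i + 1)) : ℝ) ≤ 2 / 2 / 2 ^ i := by
    intro i
    have := Rat.cast_le (K := ℝ) |>.2 (h.1 i).le
    push_cast at this
    rwa [Real.dist_eq, div_self two_ne_zero, ← one_div_pow]
  rw [abs_sub_comm, ← Real.dist_eq]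
  exact dist_le_of_le_geometric_two_of_tendsto hd h.2 n

/-- An index of the dyadic rational `a / 2 ^ (i + 2)`. -/
def dyadicCode (a i : ℕ) : ℕ :=
  Nat.pair (Nat.pair a 0) (2 ^ (i + 2) - 1)

theorem ratOfCode_dyadicCode (a i : ℕ) : ratOfCode (dyadicCode a i) = a / 2 ^ (i + 2) := by
  rw [dyadicCode, ratOfCode_pair, Nat.cast_pred (by positivity)]
  simp

theorem primrec_dyadicCode : Primrec₂ dyadicCode :=
  Primrec₂.natPair.comp (Primrec₂.natPair.comp Primrec.fst (Primrec.const 0))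
    (Primrec.pred.comp (Primrec.nat_two_pow.comp
      (Primrec.succ.comp (Primrec.succ.comp Primrec.snd))))

/-- The name of `x` by its dyadic truncations. -/
noncomputable def dyadicName (x : ℝ) (i : ℕ) : ℕ :=
  dyadicCode ⌊x * 2 ^ (i + 2)⌋₊ i

theorem abs_dyadicName_sub_lt {x : ℝ} (hx : 0 ≤ x) (i : ℕ) :
    |(ratOfCode (dyadicName x i) : ℝ) - x| < (1 / 2) ^ (i + 2) := by
  have hp : (0 : ℝ) < 2 ^ (i + 2) := by positivity
  have h₁ := Nat.floor_le (mul_nonneg hx hp.le)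
  have h₂ := Nat.lt_floor_add_one (x * 2 ^ (i + 2))
  rw [dyadicName, ratOfCode_dyadicCode, one_div_pow, abs_lt]
  push_cast
  rw [neg_lt_sub_iff_lt_add, sub_lt_iff_lt_add, ← add_div, lt_div_iff₀ hp,
    div_lt_iff₀ hp, add_mul, one_div, inv_mul_cancel₀ hp.ne']
  exact ⟨by linarith, by linarith⟩

/-- The bound of the dyadic names of the points of `[0,1]`. -/
theorem dyadicName_le {x : ℝ} (hx : x ≤ 1) (i : ℕ) :
    dyadicName x i ≤ dyadicCode (2 ^ (i + 2)) i := by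
  refine Nat.pair_le_pair_of_le (Nat.pair_le_pair_of_le ?_ le_rfl) le_rfl
  refine Nat.floor_le_of_le ?_
  push_cast
  exact mul_le_of_le_one_left (by positivity) hx

theorem monotone_dyadicCode_two_pow : Monotone fun i => dyadicCode (2 ^ (i + 2)) i := by
  intro i j hij
  have h : 2 ^ (i + 2) ≤ 2 ^ (j + 2) := Nat.pow_le_pow_right two_pos (by lia)
  exact Nat.pair_le_pair_of_le (Nat.pair_le_pair_of_le h le_rfl) (Nat.sub_le_sub_right h 1)

/-- At rational points truncation is integer division, so these names are computable. -/
theorem dyadicName_div (k N i : ℕ) :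
    dyadicName ((k : ℝ) / N) i = dyadicCode (k * 2 ^ (i + 2) / N) i := by
  rw [dyadicName, ← Nat.floor_div_eq_div (K := ℝ)]
  push_cast
  rw [div_mul_eq_mul_div]

/-- Nearby points have names with a long common initial segment. -/
theorem isFastCauchyName_ite {x y : ℝ} (hx : 0 ≤ x) (hy : 0 ≤ y) {M : ℕ}
    (hxy : |x - y| ≤ (1 / 2) ^ M) :
    IsFastCauchyName (fun i => if i < M then dyadicName x i else dyadicName y i) y := by
  set χ : ℕ → ℕ := fun i => if i < M then dyadicName x i else dyadicName y i with hχ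
  -- The point that term `i` approximates. It jumps only at `i + 1 = M`, by at most `2 ^ (-(i +
  -- 1))`; with the two truncation errors the step is below `(1/4 + 1/2 + 1/8) * 2 ^ (-i)`.
  let z : ℕ → ℝ := fun i => if i < M then x else y
  have hz : ∀ i, |(ratOfCode (χ i) : ℝ) - z i| < (1 / 2) ^ (i + 2) := by
    intro i
    simp only [hχ, z]
    split_ifs
    · exact abs_dyadicName_sub_lt hx i
    · exact abs_dyadicName_sub_lt hy i
  have hz' : ∀ i, |z i - z (i + 1)| ≤ (1 / 2) ^ (i + 1) := by
    intro i
    simp only [z]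
    split_ifs with h₁ h₂ h₂
    · simp
    · obtain rfl : M = i + 1 := by lia
      exact hxy
    · lia
    · simp
  constructor
  · intro i
    change |ratOfCode (χ i) - ratOfCode (χ (i + 1))| < (1 / 2 : ℚ) ^ i
    have h₁ := hz i
    have h₂ := hz' i
    have h₃ := hz (i + 1)
    have hp : (0 : ℝ) < (1 / 2) ^ i := by positivity
    have : |(ratOfCode (χ i) : ℝ) - ratOfCode (χ (i + 1))| < (1 / 2) ^ i := by
      rw [abs_lt] at h₁ h₃ ⊢
      rw [abs_le] at h₂
      simp only [pow_succ] at h₁ h₂ h₃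
      constructor <;> linarith
    rw [← Rat.cast_lt (K := ℝ)]
    push_cast
    exact this
  · rw [tendsto_iff_dist_tendsto_zero]
    have hlim : Tendsto (fun i : ℕ => ((1 : ℝ) / 2) ^ (i + 2)) atTop (𝓝 0) :=
      (tendsto_pow_atTop_nhds_zero_of_lt_one (by norm_num) (by norm_num)).comp
        (tendsto_add_atTop_nat 2)
    refine squeeze_zero' (Eventually.of_forall fun _ => dist_nonneg) ?_ hlim
    filter_upwards [eventually_ge_atTop M] with i hi
    rw [Real.dist_eq]
    simpa [z, hi.not_gt] using (hz i).le

theorem isFastCauchyName_dyadicName {x : ℝ} (hx : 0 ≤ x) : IsFastCauchyName (dyadicName x) x := by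
  simpa using isFastCauchyName_ite hx hx (M := 0) (by simp)

/-! ### Bernstein's estimate -/

/-- The error of a Bernstein sum with coefficients `q k` as an approximation of a number `y`: the
coefficients are close to `y` at the nodes near `x`, and bounded at the others. -/
theorem abs_sub_sum_bernstein_le {N : ℕ} (hN : N ≠ 0) {q : Fin (N + 1) → ℝ} {y K ε δ : ℝ}
    {x : Set.Icc (0 : ℝ) 1} (hy : |y| ≤ K) (hq : ∀ k, |q k| ≤ K) (hε : 0 ≤ ε) (hδ : 0 < δ)
    (hqy : ∀ k : Fin (N + 1), |(x : ℝ) - k / N| ≤ δ → |y - q k| ≤ ε) :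
    |y - ∑ k, q k * bernstein N k x| ≤ ε + K / (2 * N * δ ^ 2) := by
  have hK : 0 ≤ K := (abs_nonneg y).trans hy
  -- Chebyshev's device: beyond distance `δ`, the trivial bound `2 * K` is absorbed by a quadratic
  -- term, which averages to the variance.
  have hterm : ∀ k : Fin (N + 1),
      |y - q k| ≤ ε + 2 * K / δ ^ 2 * ((x : ℝ) - bernstein.z k) ^ 2 := by
    intro k
    rcases le_or_gt |(x : ℝ) - k / N| δ with h | h
    · exact (hqy k h).trans (le_add_of_nonneg_right (by positivity))
    · have h₁ : |y - q k| ≤ 2 * K := (abs_sub _ _).trans (by linarith [hq k])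
      have h₂ : δ ^ 2 ≤ ((x : ℝ) - bernstein.z k) ^ 2 := by
        rw [← sq_abs ((x : ℝ) - _)]
        exact pow_le_pow_left₀ hδ.le h.le 2
      have h₃ : 2 * K ≤ 2 * K / δ ^ 2 * ((x : ℝ) - bernstein.z k) ^ 2 := by
        rw [div_mul_eq_mul_div, le_div_iff₀ (by positivity)]
        exact mul_le_mul_of_nonneg_left h₂ (by positivity)
      linarith
  have hsum : y - ∑ k, q k * bernstein N k x =
      ∑ k : Fin (N + 1), (y - q k) * bernstein N k x := by
    simp only [sub_mul, Finset.sum_sub_distrib, ← Finset.mul_sum, bernstein.probability, mul_one]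
  have hvar : (x : ℝ) * (1 - x) ≤ 1 / 4 := by nlinarith [sq_nonneg ((x : ℝ) - 1 / 2)]
  have hN' : (0 : ℝ) < N := by positivity
  calc |y - ∑ k, q k * bernstein N k x|
      ≤ ∑ k : Fin (N + 1), |(y - q k) * bernstein N k x| := by
        rw [hsum]
        exact Finset.abs_sum_le_sum_abs _ _
    _ ≤ ∑ k : Fin (N + 1),
          (ε + 2 * K / δ ^ 2 * ((x : ℝ) - bernstein.z k) ^ 2) * bernstein N k x := by
        refine Finset.sum_le_sum fun k _ => ?_
        rw [abs_mul, abs_of_nonneg (bernstein_nonneg (x := x))]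
        exact mul_le_mul_of_nonneg_right (hterm k) bernstein_nonneg
    _ = ε + 2 * K / δ ^ 2 * ((x : ℝ) * (1 - x) / N) := by
        simp only [add_mul, Finset.sum_add_distrib, ← Finset.mul_sum, mul_assoc,
          bernstein.probability, mul_one, bernstein.variance hN]
    _ ≤ ε + 2 * K / δ ^ 2 * (1 / 4 / N) := by gcongr
    _ = ε + K / (2 * N * δ ^ 2) := by
        congr 1
        field_simp
        ring

/-! ### Bernstein sums in the monomial basis -/

/-- The coefficients of `X ^ k * (1 - X) ^ (N - k)`, as indices of rationals. -/
def basisCode (N k m : ℕ) : ℕ :=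
  if k ≤ m then
    if (m - k) % 2 = 0 then Nat.pair (Nat.pair ((N - k).choose (m - k)) 0) 0
    else Nat.pair (Nat.pair 0 ((N - k).choose (m - k))) 0
  else 0

theorem ratOfCode_basisCode (N k m : ℕ) :
    ratOfCode (basisCode N k m) =
      if k ≤ m then (-1) ^ (m - k) * ((N - k).choose (m - k) : ℚ) else 0 := by
  rw [basisCode]
  split_ifs with h₁ h₂
  · simp [ratOfCode_pair, (Nat.even_iff.2 h₂).neg_one_pow]
  · simp [ratOfCode_pair, (Nat.not_even_iff_odd.1 (mt Nat.even_iff.1 h₂)).neg_one_pow]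
  · exact ratOfCode_zero

theorem sum_basisCode {N k : ℕ} (hk : k ≤ N) (x : ℝ) :
    ∑ m ∈ Finset.range (N + 1), (ratOfCode (basisCode N k m) : ℝ) * x ^ m =
      x ^ k * (1 - x) ^ (N - k) := by
  obtain ⟨n, rfl⟩ := Nat.exists_eq_add_of_le hk
  rw [add_assoc, Finset.sum_range_add, Finset.sum_eq_zero, zero_add, Nat.add_sub_cancel_left,
    sub_eq_neg_add, add_pow, Finset.mul_sum]
  · refine Finset.sum_congr rfl fun m _ => ?_
    simp only [ratOfCode_basisCode, Nat.le_add_right, if_true, Nat.add_sub_cancel_left, one_pow,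
      mul_one, neg_pow x]
    push_cast
    ring
  · intro m hm
    simp [ratOfCode_basisCode, Finset.mem_range.1 hm]

theorem primrec_basisCode : Primrec fun p : ℕ × ℕ × ℕ => basisCode p.1 p.2.1 p.2.2 := by
  have hk : Primrec fun p : ℕ × ℕ × ℕ => p.2.1 := Primrec.fst.comp Primrec.snd
  have hm : Primrec fun p : ℕ × ℕ × ℕ => p.2.2 := Primrec.snd.comp Primrec.snd
  have hmk := Primrec.nat_sub.comp hm hk
  have hc := Primrec.nat_choose.comp (Primrec.nat_sub.comp Primrec.fst hk) hmk
  refine Primrec.ite (Primrec.nat_le.comp hk hm) (Primrec.ite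
    (Primrec.eq.comp (Primrec.nat_mod.comp hmk (Primrec.const 2)) (Primrec.const 0)) ?_ ?_)
    (Primrec.const 0)
  · exact Primrec₂.natPair.comp (Primrec₂.natPair.comp hc (Primrec.const 0)) (Primrec.const 0)
  · exact Primrec₂.natPair.comp (Primrec₂.natPair.comp (Primrec.const 0) hc) (Primrec.const 0)

/-- The coefficient of `X ^ m` in the Bernstein sum of degree `N` with the coefficients of indices
`c 0, …, c N`, as an index of a rational. -/
def bernsteinCoeffCode (c : ℕ → ℕ) (N m : ℕ) : ℕ :=
  sumCode (fun k => mulCode (mulCode (c k) (Nat.pair (Nat.pair (N.choose k) 0) 0))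
    (basisCode N k m)) (N + 1)

theorem primrec_bernsteinCoeffCode {c : ℕ → ℕ → ℕ} (hc : Primrec₂ c) {N : ℕ → ℕ}
    (hN : Primrec N) : Primrec₂ fun i m => bernsteinCoeffCode (c i) (N i) m := by
  refine primrec_sumCode (α := ℕ × ℕ) (c := fun p k =>
    mulCode (mulCode (c p.1 k) (Nat.pair (Nat.pair ((N p.1).choose k) 0) 0))
      (basisCode (N p.1) k p.2)) ?_ (Primrec.succ.comp (hN.comp Primrec.fst))
  have hi : Primrec fun p : (ℕ × ℕ) × ℕ => p.1.1 := Primrec.fst.comp Primrec.fst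
  have hNi := hN.comp hi
  refine primrec_mulCode.comp (primrec_mulCode.comp (hc.comp hi Primrec.snd)
    (Primrec₂.natPair.comp (Primrec₂.natPair.comp (Primrec.nat_choose.comp hNi Primrec.snd)
      (Primrec.const 0)) (Primrec.const 0))) ?_
  exact primrec_basisCode.comp
    (hNi.pair (Primrec.snd.pair (Primrec.snd.comp Primrec.fst)))

theorem aeval_polyOfCodes_bernsteinCoeffCode (c : ℕ → ℕ) (N : ℕ) (x : Set.Icc (0 : ℝ) 1) :
    Polynomial.aeval (x : ℝ)
      (polyOfCodes ((List.range (N + 1)).map (bernsteinCoeffCode c N))) =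
      ∑ k : Fin (N + 1), (ratOfCode (c k) : ℝ) * bernstein N k x := by
  rw [polyOfCodes_map_range, map_sum,
    ← Finset.sum_range fun k => (ratOfCode (c k) : ℝ) * bernstein N k x]
  simp only [map_mul, Polynomial.aeval_C, map_pow, Polynomial.aeval_X, bernsteinCoeffCode,
    ratOfCode_sumCode, eq_ratCast, Rat.cast_sum, Finset.sum_mul]
  rw [Finset.sum_comm]
  refine Finset.sum_congr rfl fun k hk => ?_
  rw [bernstein_apply, mul_assoc (N.choose k : ℝ),
    ← sum_basisCode (Nat.lt_succ_iff.1 (Finset.mem_range.1 hk)), Finset.mul_sum, Finset.mul_sum]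
  refine Finset.sum_congr rfl fun m _ => ?_
  simp only [ratOfCode_mulCode, ratOfCode_pair]
  push_cast
  ring

/-! ### The punctual Weierstrass theorem -/

theorem theorem6p1 (f : Set.Icc (0 : ℝ) 1 → ℝ) (hf : PunctuallyComputable f) :
    UniformlyPunctuallyComputable f := by
  obtain ⟨Φ, hΦ, hf⟩ := hf
  have hbound : Primrec fun i => dyadicCode (2 ^ (i + 2)) i :=
    primrec_dyadicCode.comp
      (Primrec.nat_two_pow.comp (Primrec.succ.comp Primrec.succ)) Primrec.id
  obtain ⟨B, hB, hBΦ⟩ := hΦ.exists_primrec_bound hbound monotone_dyadicCode_two_pow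
  have hval : ∀ (x : Set.Icc (0 : ℝ) 1) (n : ℕ),
      |f x - (ratOfCode (Φ (dyadicName x) n) : ℝ)| ≤ 2 / 2 ^ n := fun x n =>
    (hf x _ (isFastCauchyName_dyadicName x.2.1)).abs_sub_le n
  -- The sequence following `y` for `B n` places and `x` afterwards is a name of `x` that `Φ` cannot
  -- tell from the name of `y` at input `n`.
  have hmod : ∀ (x y : Set.Icc (0 : ℝ) 1) (n : ℕ), |(y : ℝ) - x| ≤ (1 / 2) ^ B n →
      |f x - (ratOfCode (Φ (dyadicName y) n) : ℝ)| ≤ 2 / 2 ^ n := by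
    intro x y n hxy
    have h := (hf x _ (isFastCauchyName_ite y.2.1 x.2.1 hxy)).abs_sub_le n
    rwa [(hBΦ n n le_rfl _ (dyadicName_le y.2.2)).2 _ fun i hi => if_pos hi] at h
  have hfK : ∀ x, |f x| ≤ B 0 + 2 := by
    intro x
    have h₁ := hval x 0
    have h₂ : |(ratOfCode (Φ (dyadicName x) 0) : ℝ)| ≤ B 0 := by
      have h := (abs_ratOfCode_le (Φ (dyadicName x) 0)).trans
        (Nat.cast_le.2 (hBΦ 0 0 le_rfl _ (dyadicName_le x.2.2)).1)
      exact_mod_cast h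
    have h₃ := abs_sub_abs_le_abs_sub (f x) (ratOfCode (Φ (dyadicName x) 0) : ℝ)
    rw [pow_zero] at h₁
    linarith
  -- With `K = B 0 + 4` and `δ = 2 ^ (-B (i + 2))`, this makes `K / (2 * N * δ ^ 2)` equal to half
  -- of `2 ^ (-(i + 2))`. Adding `ε = 2 / 2 ^ (i + 2)` gives a total of `5/8 * 2 ^ (-i)`.
  let N : ℕ → ℕ := fun i => (B 0 + 4) * 2 ^ (2 * B (i + 2) + (i + 2))
  let c : ℕ → ℕ → ℕ := fun i k => Φ (fun j => dyadicCode (k * 2 ^ (j + 2) / N i) j) (i + 2)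
  have hs : Primrec fun i => i + 2 := Primrec.succ.comp Primrec.succ
  have hN : Primrec N := Primrec.nat_mul.comp (Primrec.const _) (Primrec.nat_two_pow.comp
    (Primrec.nat_add.comp (Primrec.nat_mul.comp (Primrec.const 2) (hB.comp hs)) hs))
  have hc : Primrec₂ c := by
    refine (hΦ.primrec₂ (α := ℕ × ℕ)
      (g := fun p j => dyadicCode (p.2 * 2 ^ (j + 2) / N p.1) j) ?_).comp
      Primrec.id (hs.comp Primrec.fst)
    refine primrec_dyadicCode.comp (Primrec.nat_div.comp (Primrec.nat_mul.comp
      (Primrec.snd.comp Primrec.fst) (Primrec.nat_two_pow.comp (hs.comp Primrec.snd)))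
      (hN.comp (Primrec.fst.comp Primrec.fst))) Primrec.snd
  refine ⟨fun i => (List.range (N i + 1)).map (bernsteinCoeffCode (c i) (N i)),
    Primrec.list_map (Primrec.list_range.comp (Primrec.succ.comp hN))
      (primrec_bernsteinCoeffCode hc hN), fun i => ?_⟩
  have hN0 : N i ≠ 0 := by positivity
  have hcz : ∀ k : Fin (N i + 1), c i k = Φ (dyadicName (bernstein.z k : ℝ)) (i + 2) := by
    intro k
    exact congrArg (fun g => Φ g (i + 2)) (funext fun j => (dyadicName_div k (N i) j).symm)
  -- The coefficients differ from values of `f` by at most 2, whence `B 0 + 4` in place of `B 0 +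
  -- 2`.
  have hp : (2 : ℝ) / 2 ^ (i + 2) ≤ 2 :=
    div_le_self zero_le_two (one_le_pow₀ one_le_two)
  have herr : ∀ x, |f x - Polynomial.aeval (x : ℝ) (polyOfCodes
      ((List.range (N i + 1)).map (bernsteinCoeffCode (c i) (N i))))| ≤
      5 / 2 / 2 ^ (i + 2) := by
    intro x
    rw [aeval_polyOfCodes_bernsteinCoeffCode]
    refine (abs_sub_sum_bernstein_le (K := B 0 + 4) (ε := 2 / 2 ^ (i + 2))
      (δ := (1 / 2) ^ B (i + 2)) hN0 ((hfK x).trans (by linarith)) (fun k => ?_) (by positivity)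
      (by positivity) fun k hk => ?_).trans_eq ?_
    · rw [hcz]
      have h₁ := hval (bernstein.z k) (i + 2)
      have h₂ := hfK (bernstein.z k)
      rw [abs_le] at h₁ h₂ ⊢
      constructor <;> linarith
    · rw [hcz]
      exact hmod x _ _ (by rwa [abs_sub_comm])
    · have hK : ((B 0 : ℝ) + 4) ≠ 0 := by positivity
      simp only [N]
      push_cast
      rw [one_div_pow, pow_add _ (2 * _), pow_mul']
      field_simp
      norm_num
  refine ⟨⟨_, Set.forall_mem_range.2 herr⟩, (ciSup_le herr).trans_lt ?_⟩
  rw [one_div_pow, pow_add, div_div, div_lt_div_iff₀ (by positivity) (by positivity)]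
  have : (0 : ℝ) < 2 ^ i := by positivity
  linarith
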